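/- Let $S$ be a Polish space with its Borel $\sigma$-algebra, let $\mathcal P(S)$ be the set of Borel probability measures on $S$, and let $C_b(S)$ be the space of bounded continuous functions $S\to\mathbb R$. Call a set $\Gamma\subset C_b(S)$ *admissible* if 1. $\Gamma$ is convex, and closed in the weak topology on $C_b(S)$, i.e. the coarsest topology for which $g\mapsto\int_S g\,d\eta$ is continuous for every finite signed Borel measure $\eta$ on $S$; 2. $g\in\Gamma$ implies $-g\in\Gamma$, and $\Gamma$ contains all constant functions; 3. for all $\mu\ne\nu$ in $\mathcal P(S)$ there is $g\in\Gamma$ with $\int_S g\,d\mu\neq\int_S g\,d\nu$. For $\mu,\nu\in\mathcal P(S)$ and $\Gamma\subset C_b(S)$ let $$G_\Gamma(\mu\Vert\nu)=\sup_{g\in\Gamma}\Big\{\int_S g\,d\mu-\log\int_S e^{g}\,d\nu\Big\}\in[-\infty,\infty],$$ and let $R(\mu\Vert\nu)=\int_S\log\frac{d\mu}{d\nu}\,d\mu\in[0,\infty]$ if $\mu\ll\nu$, and $R(\mu\Vert\nu)=\infty$ otherwise. For $b>0$ put $b\Gamma_0=\{b f: f\in\Gamma_0\}$. **Proposition.**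 Let $\Gamma_0\subset C_b(S)$ be admissible. Then for all $\mu,\nu\in\mathcal P(S)$, $$\lim_{b\to\infty}G_{b\Gamma_0}(\mu\Vert\nu)=R(\mu\Vert\nu),$$ where the limit is taken in the extended real line over real $b>0$; in particular the left-hand side tends to $\infty$ when $R(\mu\Vert\nu)=\infty$. -/

import Mathlib

open MeasureTheory InformationTheory Filter Topology BoundedContinuousFunction
open scoped Pointwise ENNReal

namespace GammaDivergence

/-- The weak topology on `C_b(S)` induced by the space of finite signed Borel measures: the coarsest
topology making `g ↦ ∫ g dη` continuous for every finite signed measure `η`. -/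
noncomputable abbrev weakTopology (S : Type*) [TopologicalSpace S] [MeasurableSpace S] :
    TopologicalSpace (S →ᵇ ℝ) :=
  ⨅ η : SignedMeasure S,
    TopologicalSpace.induced (fun g : S →ᵇ ℝ => ∫ᵛ x, g x ∂<•η) inferInstance

/-- Admissible sets of bounded continuous test functions. -/
structure Admissible {S : Type*} [TopologicalSpace S] [MeasurableSpace S]
    (Γ : Set (S →ᵇ ℝ)) : Prop where
  convex : Convex ℝ Γ
  /-- `Γ` is closed for the weak topology (not merely for the uniform norm). -/
  closed : IsClosed[weakTopology S] Γ
  symm : ∀ g ∈ Γ, -g ∈ Γ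
  const_mem : ∀ c : ℝ, BoundedContinuousFunction.const S c ∈ Γ
  /-- `Γ` separates the Borel probability measures on `S`. -/
  determining : ∀ μ ν : ProbabilityMeasure S, μ ≠ ν →
    ∃ g ∈ Γ, ∫ x, g x ∂(μ : Measure S) ≠ ∫ x, g x ∂(ν : Measure S)

/-- The `Γ`-divergence `G_Γ(μ‖ν) = sup_{g ∈ Γ} (∫ g dμ - log ∫ e^g dν)`, with values in the
extended real line. -/
noncomputable def gammaDiv {S : Type*} [TopologicalSpace S] [MeasurableSpace S]
    (Γ : Set (S →ᵇ ℝ)) (μ ν : ProbabilityMeasure S) : EReal :=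
  ⨆ g ∈ Γ, ((∫ x, g x ∂(μ : Measure S)
    - Real.log (∫ x, Real.exp (g x) ∂(ν : Measure S)) : ℝ) : EReal)

/-- Relative entropy `R(μ‖ν)`: the integral `∫ log (dμ/dν) dμ` if `μ ≪ ν` (this integral always
exists in `(-∞, ∞]`, and it is `∞` exactly when the integrand is not integrable), and `∞`
otherwise. For probability measures this is the Kullback-Leibler divergence of Mathlib. -/
noncomputable def relEntropy {S : Type*} [MeasurableSpace S]
    (μ ν : ProbabilityMeasure S) : EReal :=
  ((klDiv (μ : Measure S) (ν : Measure S) : ℝ≥0∞) : EReal)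

end GammaDivergence

namespace GammaDivergence

/-! The upper bound is the easy half of Donsker-Varadhan. For the lower bound, suppose every
`G_{bΓ₀}(μ‖ν)` is at most `a`. As `log z ≤ z - 1`, integration against `μ` is then dominated by the
convex functional `φ(g) = ∫ e^g dν - 1 + a` on the linear span of `Γ₀`. Hahn-Banach extends it to a
linear `L ≤ φ` on all bounded measurable functions. Scaling arguments in `φ` make `L` positive and
continuous under bounded pointwise convergence, so `L` is integration against a probability measure
`γ` (`exists_measure`). It agrees with `μ` on `Γ₀`, hence `γ = μ`. So `∫ g dμ ≤ φ(g)` for every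
bounded measurable `g`, and the hard half of Donsker-Varadhan gives `R(μ‖ν) ≤ a`. -/

/-- Hahn-Banach extension dominated by a convex function. -/
theorem exists_extension_of_le_convex {E : Type*} [AddCommGroup E] [Module ℝ E]
    (p : Submodule ℝ E) (f : E →ₗ[ℝ] ℝ) (φ : E → ℝ) (hφ : ConvexOn ℝ Set.univ φ)
    (hf : ∀ x ∈ p, f x ≤ φ x) :
    ∃ g : E →ₗ[ℝ] ℝ, (∀ x ∈ p, g x = f x) ∧ ∀ x, g x ≤ φ x := by
  have h0 : 0 ≤ φ 0 := by simpa using hf 0 p.zero_mem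
  -- The perspective `(s, x) ↦ s φ(x / s)` of a convex function is jointly subadditive.
  have hadd : ∀ s t : ℝ, 0 < s → 0 < t → ∀ x y,
      (s + t) * φ ((s + t)⁻¹ • (x + y)) ≤ s * φ (s⁻¹ • x) + t * φ (t⁻¹ • y) := by
    intro s t hs ht x y
    have h := hφ.2 (Set.mem_univ (s⁻¹ • x)) (Set.mem_univ (t⁻¹ • y))
      (show 0 ≤ s / (s + t) by positivity) (show 0 ≤ t / (s + t) by positivity) (by field_simp)
    have e : (s / (s + t)) • s⁻¹ • x + (t / (s + t)) • t⁻¹ • y = (s + t)⁻¹ • (x + y) := by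
      rw [smul_smul, smul_smul, smul_add]
      congr 2 <;> field_simp
    rw [e] at h
    calc (s + t) * φ ((s + t)⁻¹ • (x + y))
        ≤ (s + t) * ((s / (s + t)) • φ (s⁻¹ • x) + (t / (s + t)) • φ (t⁻¹ • y)) := by gcongr
      _ = _ := by simp only [smul_eq_mul]; field_simp
  have hlow : ∀ x, ∀ t : Set.Ioi (0 : ℝ), -φ (-x) ≤ (t : ℝ) * φ ((t : ℝ)⁻¹ • x) := by
    rintro x ⟨t, ht⟩
    have ht : 0 < t := ht
    have h := hadd t 1 ht one_pos x (-x)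
    simp only [add_neg_cancel, smul_zero, inv_one, one_smul, one_mul] at h
    have : 0 ≤ (t + 1) * φ 0 := by positivity
    simp only
    linarith
  have hbdd : ∀ x, BddBelow (Set.range fun t : Set.Ioi (0 : ℝ) => (t : ℝ) * φ ((t : ℝ)⁻¹ • x)) :=
    fun x => ⟨-φ (-x), by rintro _ ⟨t, rfl⟩; exact hlow x t⟩
  have : Nonempty (Set.Ioi (0 : ℝ)) := ⟨⟨1, Set.mem_Ioi.2 one_pos⟩⟩
  -- Infimum of the perspectives: a sublinear functional below `φ` that still dominates `f` on `p`,
  -- since `f x = t f(x / t)`.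
  set N : E → ℝ := fun x => ⨅ t : Set.Ioi (0 : ℝ), (t : ℝ) * φ ((t : ℝ)⁻¹ • x) with hN
  have Nle : ∀ x, ∀ t : ℝ, 0 < t → N x ≤ t * φ (t⁻¹ • x) :=
    fun x t ht => ciInf_le (hbdd x) ⟨t, ht⟩
  have Nhom_le : ∀ c : ℝ, 0 < c → ∀ x, c * N x ≤ N (c • x) := by
    intro c hc x
    refine le_ciInf ?_
    rintro ⟨t, ht⟩
    have ht : 0 < t := ht
    have h := Nle x (c⁻¹ * t) (by positivity)
    have e : (c⁻¹ * t)⁻¹ • x = t⁻¹ • c • x := by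
      rw [smul_smul]; congr 1; field_simp
    rw [e] at h
    calc c * N x ≤ c * (c⁻¹ * t * φ (t⁻¹ • c • x)) := by gcongr
      _ = t * φ (t⁻¹ • c • x) := by field_simp
  obtain ⟨g, hg, hgN⟩ := exists_extension_of_le_sublinear ⟨p, f.domRestrict p⟩ N
    (fun c hc x => by
      refine le_antisymm ?_ (Nhom_le c hc x)
      have h := Nhom_le c⁻¹ (inv_pos.2 hc) (c • x)
      rw [smul_smul, inv_mul_cancel₀ hc.ne', one_smul, inv_mul_le_iff₀ hc] at h
      exact h)
    (fun x y => by
      refine le_ciInf_add_ciInf ?_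
      rintro ⟨s, hs⟩ ⟨t, ht⟩
      exact (Nle (x + y) (s + t) (add_pos hs ht)).trans (hadd s t hs ht x y))
    (fun x => by
      refine le_ciInf ?_
      rintro ⟨t, ht⟩
      have ht : 0 < t := ht
      have h := hf (t⁻¹ • (x : E)) (p.smul_mem _ x.2)
      rw [map_smul, smul_eq_mul, inv_mul_le_iff₀ ht] at h
      exact h)
  refine ⟨g, fun x hx => hg ⟨x, hx⟩, fun x => (hgN x).trans ?_⟩
  simpa using Nle x 1 one_pos

/-! ### Donsker-Varadhan variational formula -/

section KL

variable {S : Type*} [MeasurableSpace S] (μ ν : Measure S) [IsProbabilityMeasure μ]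
  [IsProbabilityMeasure ν]

/-- The easy half of the Donsker-Varadhan variational formula. -/
theorem integral_sub_log_integral_exp_le_klDiv (h : klDiv μ ν ≠ ∞) (g : S → ℝ)
    (hg : Measurable g) (C : ℝ) (hC : ∀ x, |g x| ≤ C) :
    ∫ x, g x ∂μ - Real.log (∫ x, Real.exp (g x) ∂ν) ≤ (klDiv μ ν).toReal := by
  obtain ⟨hac, hint⟩ := klDiv_ne_top_iff.1 h
  have hexp : Integrable (fun x => Real.exp (g x)) ν :=
    Integrable.of_bound (by fun_prop) (Real.exp C) (ae_of_all _ fun x => by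
      rw [Real.norm_eq_abs, Real.abs_exp]
      exact Real.exp_le_exp.2 ((le_abs_self _).trans (hC x)))
  have hZ : 0 < ∫ x, Real.exp (g x) ∂ν := integral_exp_pos hexp
  set Z := ∫ x, Real.exp (g x) ∂ν
  have hgi : Integrable g μ :=
    Integrable.of_bound (by fun_prop) C (ae_of_all _ fun x => hC x)
  have hkl : Integrable (fun x => klFun (μ.rnDeriv ν x).toReal) ν :=
    (integrable_klFun_rnDeriv_iff hac).2 hint
  rw [toReal_klDiv_eq_integral_klFun hac]
  -- Fenchel-Young for `klFun`, whose conjugate is `e^c - 1`. Taking `c = g - log Z` normalises the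
  -- exponential integral to 1.
  have hyoung : ∀ y c : ℝ, 0 ≤ y → y * c ≤ klFun y + Real.exp c - 1 := by
    intro y c hy
    rcases hy.eq_or_lt with rfl | hy
    · simp [klFun_zero, Real.exp_nonneg]
    · have h1 := Real.add_one_le_exp (c - Real.log y)
      rw [Real.exp_sub, Real.exp_log hy, le_div_iff₀ hy] at h1
      rw [klFun_apply]
      linarith
  have hi1 : Integrable (fun x => (μ.rnDeriv ν x).toReal * (g x - Real.log Z)) ν :=
    (integrable_rnDeriv_smul_iff hac).2 (hgi.sub (integrable_const _))
  have hi2 : Integrable (fun x => Real.exp (g x) / Z) ν := hexp.div_const Z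
  have hmono : ∫ x, (μ.rnDeriv ν x).toReal * (g x - Real.log Z) ∂ν
      ≤ ∫ x, (klFun (μ.rnDeriv ν x).toReal + Real.exp (g x) / Z - 1) ∂ν := by
    refine integral_mono hi1 ((hkl.add hi2).sub (integrable_const _)) fun x => ?_
    have := hyoung (μ.rnDeriv ν x).toReal (g x - Real.log Z) ENNReal.toReal_nonneg
    rwa [Real.exp_sub, Real.exp_log hZ] at this
  rw [integral_toReal_rnDeriv_mul hac, integral_sub hgi (integrable_const _),
    integral_sub (f := fun x => klFun (μ.rnDeriv ν x).toReal + Real.exp (g x) / Z) (hkl.add hi2)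
      (integrable_const _), integral_add hkl hi2, integral_div, div_self hZ.ne'] at hmono
  simpa using hmono

/-- The hard half of the Donsker-Varadhan variational formula, in its linearised form. -/
theorem klDiv_le_of_forall_integral_le (M : ℝ)
    (H : ∀ g : S → ℝ, Measurable g → (∃ C, ∀ x, |g x| ≤ C) →
      ∫ x, g x ∂μ ≤ ∫ x, Real.exp (g x) ∂ν - 1 + M) :
    klDiv μ ν ≤ ENNReal.ofReal M := by
  have hac : μ ≪ ν := by
    refine Measure.AbsolutelyContinuous.mk fun A hA hνA => ?_
    -- The test function `t 1_A` is ν-a.e. zero, so the right side of `H` stays at `M` for every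
    -- `t`.
    have hb : ∀ t : ℝ, t * μ.real A ≤ M := by
      intro t
      have h := H (A.indicator fun _ => t) (measurable_const.indicator hA)
        ⟨|t|, fun x => by by_cases hx : x ∈ A <;> simp [hx]⟩
      have e : ∫ x, Real.exp (A.indicator (fun _ => t) x) ∂ν = 1 := by
        have : (fun x => Real.exp (A.indicator (fun _ => t) x)) =ᵐ[ν] fun _ => (1 : ℝ) := by
          filter_upwards [measure_eq_zero_iff_ae_notMem.1 hνA] with x hx
          simp [hx]
        rw [integral_congr_ae this]
        simp
      rw [integral_indicator_const _ hA, e, smul_eq_mul, mul_comm] at h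
      linarith
    by_contra hne
    have hpos : 0 < μ.real A := by
      rw [measureReal_def]
      exact ENNReal.toReal_pos hne (measure_ne_top _ _)
    have := hb ((M + 1) / μ.real A)
    rw [div_mul_cancel₀ _ hpos.ne'] at this
    linarith
  set f : S → ℝ := fun x => (μ.rnDeriv ν x).toReal with hf
  have hfm : Measurable f := (Measure.measurable_rnDeriv μ ν).ennreal_toReal
  have hf0 : ∀ x, 0 ≤ f x := fun x => ENNReal.toReal_nonneg
  -- The optimal test function is `log f`; clipping `f` to `[e^-n, e^n]` makes it bounded.
  set c : ℕ → S → ℝ := fun n x => max (Real.exp (-n)) (min (f x) (Real.exp n)) with hc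
  have hcm : ∀ n, Measurable (c n) := fun n => by fun_prop
  have hc_low : ∀ (n : ℕ) x, Real.exp (-n) ≤ c n x := fun n x => le_max_left _ _
  have hc_pos : ∀ n x, 0 < c n x := fun n x => (Real.exp_pos _).trans_le (hc_low n x)
  have hc_up : ∀ (n : ℕ) x, c n x ≤ Real.exp n := fun n x =>
    max_le (Real.exp_le_exp.2 (by linarith [n.cast_nonneg (α := ℝ)])) (min_le_right _ _)
  have hlog : ∀ (n : ℕ) x, |Real.log (c n x)| ≤ n := fun n x => by
    rw [abs_le]
    exact ⟨(Real.le_log_iff_exp_le (hc_pos n x)).2 (hc_low n x),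
      (Real.log_le_iff_le_exp (hc_pos n x)).2 (hc_up n x)⟩
  -- Clipping gives `(f - c) log c ≥ 0`, so the integrand dominates `klFun c ≥ 0`; Fatou needs this
  -- sign.
  have hnonneg : ∀ n x, 0 ≤ f x * Real.log (c n x) - c n x + 1 := by
    intro n x
    have hk := klFun_nonneg (hc_pos n x).le
    rw [klFun_apply] at hk
    have key : c n x * Real.log (c n x) ≤ f x * Real.log (c n x) := by
      have hn : (0 : ℝ) ≤ n := n.cast_nonneg
      rcases le_total (f x) (Real.exp n) with h1 | h1
      · rcases le_total (f x) (Real.exp (-n)) with h2 | h2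
        · have : c n x = Real.exp (-n) := by simp [hc, h1, h2]
          rw [this, Real.log_exp]
          nlinarith
        · have : c n x = f x := by simp [hc, h1, h2]
          rw [this]
      · have : c n x = Real.exp n := by
          simp only [hc, min_eq_right h1]
          exact max_eq_right (Real.exp_le_exp.2 (by linarith))
        rw [this, Real.log_exp]
        nlinarith
    linarith
  have hlim : ∀ x, Tendsto (fun n => f x * Real.log (c n x) - c n x + 1) atTop
      (𝓝 (klFun (f x))) := by
    intro x
    have hexp : ∀ r : ℝ, ∀ᶠ n : ℕ in atTop, r ≤ Real.exp n := fun r =>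
      (Real.tendsto_exp_atTop.comp tendsto_natCast_atTop_atTop).eventually_ge_atTop r
    have hexpneg : Tendsto (fun n : ℕ => Real.exp (-n)) atTop (𝓝 0) :=
      Real.tendsto_exp_neg_atTop_nhds_zero.comp tendsto_natCast_atTop_atTop
    rcases (hf0 x).eq_or_lt with h0 | h0
    · have : ∀ n, f x * Real.log (c n x) - c n x + 1 = 0 - Real.exp (-n) + 1 := fun n => by
        simp [hc, ← h0, Real.exp_nonneg]
      rw [tendsto_congr this, ← h0, klFun_zero]
      simpa using (hexpneg.const_sub 0).add_const 1
    · refine tendsto_const_nhds.congr' ?_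
      filter_upwards [hexp (f x), hexpneg.eventually_le_const h0] with n h1 h2
      have : c n x = f x := by simp [hc, h1, h2]
      rw [this, klFun_apply]
      ring
  have hint : ∀ n, ∫⁻ x, ENNReal.ofReal (f x * Real.log (c n x) - c n x + 1) ∂ν
      ≤ ENNReal.ofReal M := by
    intro n
    have hi0 : Integrable (fun x => Real.log (c n x)) μ :=
      Integrable.of_bound (hcm n).log.aestronglyMeasurable n (ae_of_all _ fun x => hlog n x)
    have hi1 : Integrable (fun x => f x * Real.log (c n x)) ν :=
      (integrable_rnDeriv_smul_iff hac).2 hi0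
    have hi2 : Integrable (c n) ν :=
      Integrable.of_bound (by fun_prop) (Real.exp n) (ae_of_all _ fun x => by
        rw [Real.norm_eq_abs, abs_of_pos (hc_pos n x)]; exact hc_up n x)
    rw [← ofReal_integral_eq_lintegral_ofReal
      (f := fun x => f x * Real.log (c n x) - c n x + 1) ((hi1.sub hi2).add (integrable_const _)) (ae_of_all _ fun x => hnonneg n x)]
    refine ENNReal.ofReal_le_ofReal ?_
    rw [integral_add (f := fun x => f x * Real.log (c n x) - c n x) (hi1.sub hi2)
        (integrable_const _), integral_sub hi1 hi2,
      integral_toReal_rnDeriv_mul hac]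
    have h := H (fun x => Real.log (c n x)) (by fun_prop) ⟨n, hlog n⟩
    simp only [Real.exp_log (hc_pos n _)] at h
    simp only [integral_const, probReal_univ, smul_eq_mul, mul_one]
    linarith
  rw [klDiv_eq_lintegral_klFun_of_ac hac]
  calc ∫⁻ x, ENNReal.ofReal (klFun (f x)) ∂ν
      = ∫⁻ x, liminf (fun n => ENNReal.ofReal (f x * Real.log (c n x) - c n x + 1)) atTop ∂ν :=
        lintegral_congr fun x => ((ENNReal.tendsto_ofReal (hlim x)).liminf_eq).symm
    _ ≤ liminf (fun n => ∫⁻ x, ENNReal.ofReal (f x * Real.log (c n x) - c n x + 1) ∂ν) atTop :=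
        lintegral_liminf_le fun n => by fun_prop
    _ ≤ ENNReal.ofReal M := by
        refine (liminf_le_liminf (Eventually.of_forall hint)).trans ?_
        simp

end KL

/-! ### Functionals dominated by an exponential integral -/

/-- The space of bounded measurable real functions. -/
def boundedMeasurable (S : Type*) [MeasurableSpace S] : Submodule ℝ (S → ℝ) where
  carrier := {f | Measurable f ∧ ∃ C, ∀ x, |f x| ≤ C}
  zero_mem' := ⟨measurable_const, 0, by simp⟩
  add_mem' := by
    rintro f g ⟨hf, C, hC⟩ ⟨hg, D, hD⟩
    exact ⟨hf.add hg, C + D, fun x => (abs_add_le _ _).trans (add_le_add (hC x) (hD x))⟩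
  smul_mem' := by
    rintro c f ⟨hf, C, hC⟩
    refine ⟨hf.const_smul c, |c| * C, fun x => ?_⟩
    rw [Pi.smul_apply, smul_eq_mul, abs_mul]
    exact mul_le_mul_of_nonneg_left (hC x) (abs_nonneg c)

namespace boundedMeasurable

variable {S : Type*} [MeasurableSpace S]

theorem measurable (g : boundedMeasurable S) : Measurable (g : S → ℝ) := g.2.1

theorem integrable (μ : Measure S) [IsFiniteMeasure μ] (g : boundedMeasurable S) :
    Integrable (g : S → ℝ) μ := by
  obtain ⟨C, hC⟩ := g.2.2
  exact Integrable.of_bound g.2.1.aestronglyMeasurable C (ae_of_all _ hC)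

theorem integrable_exp (μ : Measure S) [IsFiniteMeasure μ] (g : boundedMeasurable S) :
    Integrable (fun x => Real.exp ((g : S → ℝ) x)) μ := by
  obtain ⟨C, hC⟩ := g.2.2
  refine Integrable.of_bound g.2.1.exp.aestronglyMeasurable (Real.exp C) (ae_of_all _ fun x => ?_)
  rw [Real.norm_eq_abs, Real.abs_exp]
  exact Real.exp_le_exp.2 ((le_abs_self _).trans (hC x))

/-- Integration as a linear functional on bounded measurable functions. -/
noncomputable def integral (μ : Measure S) [IsFiniteMeasure μ] : boundedMeasurable S →ₗ[ℝ] ℝ where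
  toFun g := ∫ x, (g : S → ℝ) x ∂μ
  map_add' f g := integral_add (integrable μ f) (integrable μ g)
  map_smul' c _ := integral_const_mul c _

theorem integral_apply (μ : Measure S) [IsFiniteMeasure μ] (g : boundedMeasurable S) :
    integral μ g = ∫ x, (g : S → ℝ) x ∂μ := rfl

/-- The constant functions. -/
def const (c : ℝ) : boundedMeasurable S := ⟨fun _ => c, measurable_const, |c|, fun _ => le_rfl⟩

/-- The indicator function of a measurable set. -/
noncomputable def ind (A : Set S) (hA : MeasurableSet A) : boundedMeasurable S :=
  ⟨A.indicator fun _ => 1, measurable_const.indicator hA, 1,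
    fun x => by by_cases hx : x ∈ A <;> simp [hx]⟩

/-- A simple function, as a bounded measurable function. -/
def ofSimple (s : SimpleFunc S ℝ) : boundedMeasurable S :=
  ⟨s, s.measurable, s.exists_forall_norm_le⟩

variable (ν : Measure S) [IsProbabilityMeasure ν] (L : boundedMeasurable S →ₗ[ℝ] ℝ) (M : ℝ)

theorem convexOn_integral_exp :
    ConvexOn ℝ Set.univ
      (fun g : boundedMeasurable S => ∫ x, Real.exp ((g : S → ℝ) x) ∂ν - 1 + M) := by
  refine ⟨convex_univ, fun f _ g _ a b ha hb hab => ?_⟩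
  have h : ∫ x, Real.exp (((a • f + b • g : boundedMeasurable S) : S → ℝ) x) ∂ν
      ≤ ∫ x, (a * Real.exp ((f : S → ℝ) x) + b * Real.exp ((g : S → ℝ) x)) ∂ν :=
    integral_mono (integrable_exp ν _)
      (((integrable_exp ν f).const_mul a).add ((integrable_exp ν g).const_mul b))
      fun x => convexOn_exp.2 (Set.mem_univ _) (Set.mem_univ _) ha hb hab
  rw [integral_add ((integrable_exp ν f).const_mul a) ((integrable_exp ν g).const_mul b),
    integral_const_mul, integral_const_mul] at h
  have e : a * (-1 + M) + b * (-1 + M) = -1 + M := by rw [← add_mul, hab, one_mul]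
  simp only [smul_eq_mul]
  linarith

variable {ν L M}
variable (H : ∀ g : boundedMeasurable S, L g ≤ ∫ x, Real.exp ((g : S → ℝ) x) ∂ν - 1 + M)
include H

/-- Testing `t • h n` gives `t L(h n) ≤ ∫ e^{t h n} dν - 1 + M`, which tends to `M`; a fixed `t > M
/ ε` suffices. -/
theorem eventually_lt_of_tendsto_zero (h : ℕ → boundedMeasurable S) (C : ℝ)
    (hC : ∀ n x, |(h n : S → ℝ) x| ≤ C)
    (hlim : ∀ x, Tendsto (fun n => (h n : S → ℝ) x) atTop (𝓝 0)) (ε : ℝ) (hε : 0 < ε) :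
    ∀ᶠ n in atTop, L (h n) < ε := by
  set t : ℝ := (|M| + 1) / ε with ht
  have htpos : 0 < t := by positivity
  have hdct : Tendsto (fun n => ∫ x, Real.exp (t * (h n : S → ℝ) x) ∂ν) atTop
      (𝓝 (∫ _, Real.exp (t * 0) ∂ν)) := by
    refine tendsto_integral_of_dominated_convergence (fun _ => Real.exp (t * C))
      (fun n => ((measurable (h n)).const_mul t).exp.aestronglyMeasurable) (integrable_const _)
      (fun n => ae_of_all _ fun x => ?_) (ae_of_all _ fun x => ?_)
    · rw [Real.norm_eq_abs, Real.abs_exp]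
      exact Real.exp_le_exp.2
        (mul_le_mul_of_nonneg_left ((le_abs_self _).trans (hC n x)) htpos.le)
    · exact (Real.continuous_exp.tendsto _).comp ((hlim x).const_mul t)
  simp only [mul_zero, Real.exp_zero, integral_const, probReal_univ, smul_eq_mul, mul_one]
    at hdct
  have hM : 1 < t * ε + 1 - M := by
    rw [ht, div_mul_cancel₀ _ hε.ne']
    linarith [le_abs_self M]
  filter_upwards [hdct.eventually_lt_const hM] with n hn
  have h1 : L (t • h n) ≤ ∫ x, Real.exp (t * (h n : S → ℝ) x) ∂ν - 1 + M := H (t • h n)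
  rw [map_smul, smul_eq_mul] at h1
  exact lt_of_mul_lt_mul_left (by linarith) htpos.le

theorem tendsto_zero (h : ℕ → boundedMeasurable S) (C : ℝ)
    (hC : ∀ n x, |(h n : S → ℝ) x| ≤ C)
    (hlim : ∀ x, Tendsto (fun n => (h n : S → ℝ) x) atTop (𝓝 0)) :
    Tendsto (fun n => L (h n)) atTop (𝓝 0) := by
  refine Metric.tendsto_nhds.2 fun ε hε => ?_
  have h2 := eventually_lt_of_tendsto_zero H (fun n => -h n) C
    (fun n x => (abs_neg _).trans_le (hC n x))
    (fun x => by simpa using (hlim x).neg) ε hε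
  filter_upwards [eventually_lt_of_tendsto_zero H h C hC hlim ε hε, h2] with n h1 h2
  rw [map_neg] at h2
  rw [Real.dist_0_eq_abs, abs_lt]
  exact ⟨by linarith, h1⟩

theorem tendsto_of_tendsto (h : ℕ → boundedMeasurable S) (g : boundedMeasurable S) (C : ℝ)
    (hC : ∀ n x, |(h n : S → ℝ) x| ≤ C)
    (hlim : ∀ x, Tendsto (fun n => (h n : S → ℝ) x) atTop (𝓝 ((g : S → ℝ) x))) :
    Tendsto (fun n => L (h n)) atTop (𝓝 (L g)) := by
  obtain ⟨D, hD⟩ := g.2.2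
  have := tendsto_zero H (fun n => h n - g) (C + D)
    (fun n x => (abs_sub _ _).trans (add_le_add (hC n x) (hD x)))
    (fun x => by simpa using (hlim x).sub_const ((g : S → ℝ) x))
  simpa using this.add_const (L g)

/-- Since `e^{-t g} ≤ 1`, domination at `-t • g` gives `-t L g ≤ M` for all `t > 0`. -/
theorem nonneg_of_nonneg (g : boundedMeasurable S) (hg : ∀ x, 0 ≤ (g : S → ℝ) x) : 0 ≤ L g := by
  by_contra! hneg
  set t : ℝ := (|M| + 1) / (-L g) with ht
  have htpos : 0 < t := div_pos (by positivity) (by linarith)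
  have h1 : L ((-t) • g) ≤ ∫ x, Real.exp (-t * (g : S → ℝ) x) ∂ν - 1 + M := H ((-t) • g)
  have h2 : ∫ x, Real.exp (-t * (g : S → ℝ) x) ∂ν ≤ ∫ _, 1 ∂ν :=
    integral_mono (integrable_exp ν ((-t) • g)) (integrable_const _) fun x =>
      Real.exp_le_one_iff.2 (by nlinarith [hg x])
  have h3 : t * (-L g) = |M| + 1 := div_mul_cancel₀ _ (by linarith)
  rw [map_smul, smul_eq_mul] at h1
  simp only [integral_const, probReal_univ, smul_eq_mul, mul_one] at h2
  linarith [le_abs_self M]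

theorem hasSum_ind (A : ℕ → Set S) (hA : ∀ i, MeasurableSet (A i))
    (hd : Pairwise (Function.onFun Disjoint A)) :
    HasSum (fun i => L (ind (A i) (hA i))) (L (ind (⋃ i, A i) (MeasurableSet.iUnion hA))) := by
  rw [hasSum_iff_tendsto_nat_of_nonneg fun i => nonneg_of_nonneg H _ fun x =>
    Set.indicator_nonneg (fun _ _ => zero_le_one) x]
  have hsum : ∀ n x, ((∑ i ∈ Finset.range n, ind (A i) (hA i) : boundedMeasurable S) : S → ℝ) x
      = (⋃ i ∈ Finset.range n, A i).indicator (fun _ => (1 : ℝ)) x := by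
    intro n x
    rw [Finset.indicator_biUnion _ _ fun i _ j _ hij => hd hij]
    simp [ind, Finset.sum_apply]
  simp only [← map_sum]
  refine tendsto_of_tendsto H _ _ 1 (fun n x => ?_) fun x => ?_
  · rw [hsum]
    by_cases hx : x ∈ ⋃ i ∈ Finset.range n, A i
    · rw [Set.indicator_of_mem hx, abs_one]
    · rw [Set.indicator_of_notMem hx, abs_zero]; exact zero_le_one
  · simp only [hsum]
    exact ((tendsto_indicator_biUnion_finset A (fun _ => (1 : ℝ)) x).mono_right
      (pure_le_nhds _)).comp tendsto_finset_range

/-- A linear functional dominated by an exponential integral is represented by a measure. -/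
theorem exists_measure (h1 : L (const 1) = 1) :
    ∃ γ : Measure S, IsProbabilityMeasure γ ∧
      ∀ g : boundedMeasurable S, ∫ x, (g : S → ℝ) x ∂γ = L g := by
  have hnn : ∀ A hA, 0 ≤ L (ind A hA) := fun A hA => nonneg_of_nonneg H _ fun x =>
    Set.indicator_nonneg (fun _ _ => zero_le_one) x
  let γ : Measure S := Measure.ofMeasurable (fun A hA => ENNReal.ofReal (L (ind A hA)))
    (by
      have : ind (∅ : Set S) MeasurableSet.empty = 0 := Subtype.ext (by simp [ind]; rfl)
      rw [this, map_zero, ENNReal.ofReal_zero])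
    (fun A hA hd => by
      have hs := hasSum_ind H A hA hd
      rw [← hs.tsum_eq, ENNReal.ofReal_tsum_of_nonneg (fun i => hnn _ _) hs.summable])
  have hγ : ∀ A hA, γ A = ENNReal.ofReal (L (ind A hA)) := fun A hA =>
    Measure.ofMeasurable_apply A hA
  have hprob : IsProbabilityMeasure γ := ⟨by
    have : ind (Set.univ : Set S) MeasurableSet.univ = const 1 := Subtype.ext (by simp [ind, const])
    rw [hγ _ MeasurableSet.univ, this, h1, ENNReal.ofReal_one]⟩
  have hsimple : ∀ s : SimpleFunc S ℝ, ∫ x, s x ∂γ = L (ofSimple s) := by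
    intro s
    induction s using SimpleFunc.induction with
    | const c hA =>
      rename_i A
      have e : ofSimple (SimpleFunc.piecewise A hA (SimpleFunc.const _ c) (SimpleFunc.const _ 0))
          = c • ind A hA := by
        refine Subtype.ext (funext fun x => ?_)
        by_cases hx : x ∈ A <;> simp [ofSimple, ind, hx]
      have e2 : ∫ x, (SimpleFunc.piecewise A hA (SimpleFunc.const _ c) (SimpleFunc.const _ 0)) x ∂γ
          = ∫ x, A.indicator (fun _ => c) x ∂γ := by
        congr 1
      rw [e2, e, integral_indicator_const c hA, map_smul, measureReal_def, hγ A hA,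
        ENNReal.toReal_ofReal (hnn A hA), smul_eq_mul, smul_eq_mul, mul_comm]
    | add _ hf hg =>
      rename_i f g _
      have e : ofSimple (f + g) = ofSimple f + ofSimple g := rfl
      rw [e, map_add, ← hf, ← hg]
      exact integral_add (integrable γ (ofSimple f)) (integrable γ (ofSimple g))
  refine ⟨γ, hprob, fun g => ?_⟩
  obtain ⟨C, hC⟩ := g.2.2
  let s : ℕ → SimpleFunc S ℝ := SimpleFunc.approxOn g g.2.1 Set.univ 0 (Set.mem_univ _)
  have hsC : ∀ n x, |s n x| ≤ C + C := fun n x =>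
    (SimpleFunc.norm_approxOn_zero_le g.2.1 (Set.mem_univ _) x n).trans
      (add_le_add (hC x) (hC x))
  have hslim : ∀ x, Tendsto (fun n => s n x) atTop (𝓝 ((g : S → ℝ) x)) := fun x =>
    SimpleFunc.tendsto_approxOn g.2.1 (Set.mem_univ _) (by simp)
  refine tendsto_nhds_unique (f := fun n => ∫ x, s n x ∂γ) (l := atTop) ?_ ?_
  · exact tendsto_integral_of_dominated_convergence (fun _ => C + C)
      (fun n => (s n).measurable.aestronglyMeasurable) (integrable_const _)
      (fun n => ae_of_all _ (hsC n)) (ae_of_all _ hslim)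
  · simp only [hsimple]
    exact tendsto_of_tendsto H (fun n => ofSimple (s n)) g (C + C) hsC hslim

end boundedMeasurable

/-! ### Admissible sets and the two bounds -/

namespace Admissible

variable {S : Type*} [TopologicalSpace S] [MeasurableSpace S] {Γ : Set (S →ᵇ ℝ)}

theorem zero_mem (hΓ : Admissible Γ) : (0 : S →ᵇ ℝ) ∈ Γ := hΓ.const_mem 0

theorem smul_subset_smul (hΓ : Admissible Γ) {b c : ℝ} (hb : 0 < b) (hbc : b ≤ c) :
    b • Γ ⊆ c • Γ := by
  rintro _ ⟨g, hg, rfl⟩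
  have hc : 0 < c := hb.trans_le hbc
  refine ⟨(b / c) • g, hΓ.convex.smul_mem_of_zero_mem hΓ.zero_mem hg
    ⟨by positivity, (div_le_one hc).2 hbc⟩, ?_⟩
  simp only [smul_smul, mul_div_cancel₀ b hc.ne']

/-- The linear span of an admissible set, as a space of bounded measurable functions. -/
def linearSpan (hΓ : Admissible Γ) : Submodule ℝ (boundedMeasurable S) where
  carrier := {f | ∃ b : ℝ, 0 < b ∧ ∃ g ∈ Γ, ∀ x, (f : S → ℝ) x = b * g x}
  zero_mem' := ⟨1, one_pos, 0, hΓ.zero_mem, by simp⟩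
  add_mem' := by
    rintro f₁ f₂ ⟨b₁, hb₁, g₁, hg₁, h₁⟩ ⟨b₂, hb₂, g₂, hg₂, h₂⟩
    refine ⟨b₁ + b₂, by positivity, _,
      hΓ.convex hg₁ hg₂ (show 0 ≤ b₁ / (b₁ + b₂) by positivity)
        (show 0 ≤ b₂ / (b₁ + b₂) by positivity) (by field_simp), fun x => ?_⟩
    simp only [Submodule.coe_add, Pi.add_apply, h₁, h₂, BoundedContinuousFunction.coe_add,
      BoundedContinuousFunction.coe_smul, smul_eq_mul]
    field_simp
  smul_mem' := by
    rintro c f ⟨b, hb, g, hg, h⟩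
    rcases lt_trichotomy c 0 with hc | rfl | hc
    · exact ⟨-c * b, mul_pos (neg_pos.2 hc) hb, -g, hΓ.symm g hg, fun x => by simp [h]; ring⟩
    · exact ⟨1, one_pos, 0, hΓ.zero_mem, by simp⟩
    · exact ⟨c * b, mul_pos hc hb, g, hg, fun x => by simp [h]; ring⟩

theorem klDiv_le_of_forall_mem [BorelSpace S] (hΓ : Admissible Γ) (μ ν : ProbabilityMeasure S)
    (a : ℝ) (h : ∀ b : ℝ, 0 < b → ∀ g ∈ b • Γ, ∫ x, g x ∂(μ : Measure S)
      - Real.log (∫ x, Real.exp (g x) ∂(ν : Measure S)) ≤ a) :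
    klDiv (μ : Measure S) (ν : Measure S) ≤ ENNReal.ofReal a := by
  obtain ⟨L, hLp, hL⟩ := exists_extension_of_le_convex hΓ.linearSpan
    (boundedMeasurable.integral (μ : Measure S)) _
    (boundedMeasurable.convexOn_integral_exp (ν : Measure S) a) (by
      rintro f ⟨b, hb, g, hg, hfg⟩
      have h1 := h b hb (b • g) (Set.smul_mem_smul_set hg)
      simp only [BoundedContinuousFunction.coe_smul, smul_eq_mul, ← hfg] at h1
      have h2 := Real.log_le_sub_one_of_pos
        (integral_exp_pos (boundedMeasurable.integrable_exp (ν : Measure S) f))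
      rw [boundedMeasurable.integral_apply]
      linarith)
  have hone : L (boundedMeasurable.const 1) = 1 := by
    rw [hLp _ ⟨1, one_pos, _, hΓ.const_mem 1, fun x => by simp [boundedMeasurable.const]⟩,
      boundedMeasurable.integral_apply]
    simp [boundedMeasurable.const]
  obtain ⟨γ, hγ, hLγ⟩ := boundedMeasurable.exists_measure hL hone
  have hμγ : μ = ⟨γ, hγ⟩ := by
    by_contra hne
    obtain ⟨g, hg, hgne⟩ := hΓ.determining _ _ hne
    let f : boundedMeasurable S := ⟨g, g.continuous.measurable, ‖g‖, g.norm_coe_le_norm⟩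
    have hf : f ∈ hΓ.linearSpan := ⟨1, one_pos, g, hg, fun x => (one_mul _).symm⟩
    exact hgne ((hLp f hf).symm.trans (hLγ f).symm)
  refine klDiv_le_of_forall_integral_le _ _ a fun g hg hgb => ?_
  rw [hμγ]
  exact (hLγ ⟨g, hg, hgb⟩).trans_le (hL ⟨g, hg, hgb⟩)

end Admissible

theorem gammaDiv_le_relEntropy {S : Type*} [TopologicalSpace S] [MeasurableSpace S]
    [OpensMeasurableSpace S] (Γ : Set (S →ᵇ ℝ)) (μ ν : ProbabilityMeasure S) :
    gammaDiv Γ μ ν ≤ relEntropy μ ν := by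
  refine iSup₂_le fun g _ => ?_
  by_cases htop : klDiv (μ : Measure S) (ν : Measure S) = ∞
  · simp [relEntropy, htop]
  · rw [relEntropy, ← EReal.coe_toReal (x := (klDiv (μ : Measure S) (ν : Measure S) : EReal))
      (by simpa using htop) (by simp), EReal.coe_le_coe_iff, EReal.toReal_coe_ennreal]
    exact integral_sub_log_integral_exp_le_klDiv _ _ htop g g.continuous.measurable ‖g‖
      g.norm_coe_le_norm

end GammaDivergence

theorem mainTheorem7 {S : Type*} [TopologicalSpace S] [PolishSpace S]
    [MeasurableSpace S] [BorelSpace S]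
    (Γ₀ : Set (S →ᵇ ℝ)) (hΓ₀ : GammaDivergence.Admissible Γ₀)
    (μ ν : ProbabilityMeasure S) :
    Tendsto (fun b : ℝ => GammaDivergence.gammaDiv (b • Γ₀) μ ν) atTop
      (𝓝 (GammaDivergence.relEntropy μ ν)) := by
  refine tendsto_order.2 ⟨fun a ha => ?_, fun a ha => Eventually.of_forall fun b =>
    (GammaDivergence.gammaDiv_le_relEntropy _ μ ν).trans_lt ha⟩
  obtain ⟨r, har, hr⟩ := EReal.lt_iff_exists_real_btwn.1 ha
  have hex : ∃ b : ℝ, 0 < b ∧ ∃ g ∈ b • Γ₀, r < ∫ x, g x ∂(μ : Measure S)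
      - Real.log (∫ x, Real.exp (g x) ∂(ν : Measure S)) := by
    by_contra! hcon
    -- Needed because `ENNReal.ofReal` sends negative reals to 0.
    have hr0 : 0 ≤ r := by
      simpa using hcon 1 one_pos 0 (by simpa using hΓ₀.zero_mem)
    have hle := EReal.coe_ennreal_le_coe_ennreal_iff.2 (hΓ₀.klDiv_le_of_forall_mem μ ν r hcon)
    rw [EReal.coe_ennreal_ofReal, max_eq_left hr0] at hle
    exact hle.not_gt hr
  obtain ⟨b, hb, g, hg, hrg⟩ := hex
  -- The sets `c • Γ₀` increase with `c`, so one good `b` serves all larger `c`.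
  filter_upwards [eventually_ge_atTop b] with c hbc
  refine har.trans ((EReal.coe_lt_coe_iff.2 hrg).trans_le ?_)
  exact le_iSup₂_of_le g (hΓ₀.smul_subset_smul hb hbc hg) le_rfl
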